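/- Let $\Sigma$ be a finite alphabet, let $L\subseteq\Sigma^*$ be an arbitrary language (not necessarily computable), and let $0<\varepsilon<\tfrac12$. Then $L$ has a weak interactive proof system $(P,V)$ with error bound $\varepsilon$ whose verifier $V$ is a sweeping probabilistic finite automaton. Here $V$ is a two-way probabilistic finite automaton, with arbitrary real transition probabilities and without a work tape, reading the input between two end-markers and equipped with a one-symbol communication cell over a finite alphabet $\Upsilon$. Its finite state set is partitioned into reading states (one of them initial), communicating states, an accepting and a rejecting halting state. In a reading state, the next state and the head move (left, stay, right) are chosen at random, with probabilities depending on the state and the symbol under the head, which never leaves the part of the tape delimited by the end-markers; in a communicating state $s$, $V$ writes a symbol $\tau_s\in\Upsilon$, the prover replies with some $\tau\in\Upsilon$, and the next state is determined by $s$ and $\tau$. The computation ends when a halting state is entered. $V$ is sweeping if the direction of the input head can change only on the end-markers. A prover is an arbitrary function giving its reply from the input and the sequence of symbols written by $V$ so far; it does not see the random choices of $V$. The pair $(P,V)$ is a weak interactive proof system for $L$ with error bound $\varepsilon$ if 1. every $x\in L$ is accepted by $V$ with probability at least $1-\varepsilon$ when communicating with $P$; and 2. every $x\in\Sigma^*\setminus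 L$ is accepted by $V$ with probability at most $\varepsilon$ when communicating with any prover $P^*$. (In particular, non-members need not be rejected with high probability: the computation may run forever.) -/

import Mathlib

open scoped ENNReal

namespace WeakIPS

/-- The content of a cell of the input tape: a letter or one of the two end-markers. -/
inductive TapeSymbol (α : Type*) where
  | leftEnd : TapeSymbol α
  | letter : α → TapeSymbol α
  | rightEnd : TapeSymbol α

/-- The possible moves of the input head (`stay`: the head does not move). -/
inductive Move where
  | left : Move
  | stay : Move
  | right : Move

/-- The states of a verifier, partitioned into reading states, communicating states and the two
halting states (accepting and rejecting). -/
inductive State (R C : Type) where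
  | read : R → State R C
  | comm : C → State R C
  | accept : State R C
  | reject : State R C

/-- A constant-space verifier with input alphabet `α`: a two-way probabilistic finite automaton
(no work tape) with a communication cell. Transition probabilities are arbitrary reals. -/
structure Verifier (α : Type*) where
  /-- the reading states -/
  R : Type
  /-- the communicating states -/
  C : Type
  /-- the communication alphabet -/
  Msg : Type
  finite_R : Finite R
  finite_C : Finite C
  finite_Msg : Finite Msg
  /-- the initial state, a reading state -/
  start : R
  /-- in a reading state: the distribution of the next state and of the move of the head, given
  the symbol under the head -/
  deltaRead : R → TapeSymbol α → PMF (State R C × Move)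
  /-- the symbol that a communicating state writes on the communication cell -/
  write : C → Msg
  /-- in a communicating state: the next state, given the reply of the prover -/
  deltaComm : C → Msg → State R C
  /-- the head never moves to the left of the left end-marker -/
  not_left : ∀ r s, deltaRead r TapeSymbol.leftEnd (s, Move.left) = 0
  /-- the head never moves to the right of the right end-marker -/
  not_right : ∀ r s, deltaRead r TapeSymbol.rightEnd (s, Move.right) = 0

/-- The input tape of `w`: cell `0` holds the left end-marker, cells `1, …, |w|` hold `w`, and
cell `|w| + 1` holds the right end-marker (cells further to the right are never visited). -/
def tape {α : Type*} (w : List α) : ℕ → TapeSymbol α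
  | 0 => TapeSymbol.leftEnd
  | i + 1 =>
    match w[i]? with
    | some a => TapeSymbol.letter a
    | none => TapeSymbol.rightEnd

/-- The new position of the head. -/
def Move.apply : Move → ℕ → ℕ
  | Move.left, i => i - 1
  | Move.stay, i => i
  | Move.right, i => i + 1

namespace Verifier

variable {α : Type*}

/-- A prover that may communicate with `V`: it replies as an arbitrary function of the input and
of the sequence of all the symbols written by the verifier so far (the last one included). It sees
neither the states, nor the head, nor the random choices of the verifier. -/
def Prover (V : Verifier α) : Type _ := List α → List V.Msg → V.Msg

/-- A configuration: the state, the position of the input head, and the symbols written on the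
communication cell by the verifier so far. -/
structure Config (V : Verifier α) where
  state : State V.R V.C
  pos : ℕ
  sent : List V.Msg

/-- The initial configuration. -/
def init (V : Verifier α) : V.Config := ⟨State.read V.start, 0, []⟩

/-- The distribution of the next configuration on input `w` with prover `P`. Halting
configurations are absorbing. -/
noncomputable def step (V : Verifier α) (P : V.Prover) (w : List α) : V.Config → PMF V.Config
  | ⟨State.read r, i, h⟩ =>
      (V.deltaRead r (tape w i)).map fun x => ⟨x.1, x.2.apply i, h⟩
  | ⟨State.comm c, i, h⟩ =>
      PMF.pure ⟨V.deltaComm c (P w (h ++ [V.write c])), i, h ++ [V.write c]⟩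
  | ⟨State.accept, i, h⟩ => PMF.pure ⟨State.accept, i, h⟩
  | ⟨State.reject, i, h⟩ => PMF.pure ⟨State.reject, i, h⟩

/-- The distribution of the configuration after `t` steps, starting from a given configuration. -/
noncomputable def run (V : Verifier α) (P : V.Prover) (w : List α) : ℕ → V.Config → PMF V.Config
  | 0, c => PMF.pure c
  | t + 1, c => (V.step P w c).bind (V.run P w t)

/-- The probability that `V` accepts `w` when communicating with `P`: the supremum (limit) over
`t` of the probability of being in the accepting state after `t` steps. -/
noncomputable def acceptProb (V : Verifier α) (P : V.Prover) (w : List α) : ℝ≥0∞ :=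
  ⨆ t : ℕ, ((V.run P w t V.init).map Config.state) State.accept

/-- `V.Reach w s i d`: on input `w`, for some replies of the prover and with positive probability,
`V` comes to state `s` with the head at position `i`, and `d` is the direction of the last
non-stationary move (`right` if the head has not moved yet). -/
inductive Reach (V : Verifier α) (w : List α) : State V.R V.C → ℕ → Move → Prop
  | init : Reach V w (State.read V.start) 0 Move.right
  | comm {c : V.C} {i : ℕ} {d : Move} (m : V.Msg) :
      Reach V w (State.comm c) i d → Reach V w (V.deltaComm c m) i d
  | stay {r : V.R} {i : ℕ} {d : Move} {s : State V.R V.C} :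
      Reach V w (State.read r) i d → V.deltaRead r (tape w i) (s, Move.stay) ≠ 0 →
      Reach V w s i d
  | move {r : V.R} {i : ℕ} {d m : Move} {s : State V.R V.C} :
      Reach V w (State.read r) i d → m ≠ Move.stay → V.deltaRead r (tape w i) (s, m) ≠ 0 →
      Reach V w s (m.apply i) m

/-- `V` is sweeping: on every input, whatever the prover replies, the direction of the input head
is changed only on the end-markers. -/
def IsSweeping (V : Verifier α) : Prop :=
  ∀ (w : List α) (r : V.R) (i : ℕ) (d m : Move) (s : State V.R V.C),
    V.Reach w (State.read r) i d → V.deltaRead r (tape w i) (s, m) ≠ 0 →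
    m ≠ Move.stay → m ≠ d → i = 0 ∨ i = w.length + 1

/-- `(P, V)` is a weak interactive proof system for `L` with error bound `ε`: `V` accepts every
member with probability at least `1 - ε` when communicating with `P`, and accepts every non-member
with probability at most `ε` when communicating with any prover. -/
def IsWeakIPS (V : Verifier α) (P : V.Prover) (L : Language α) (ε : ℝ) : Prop :=
  (∀ x ∈ L, ENNReal.ofReal (1 - ε) ≤ V.acceptProb P x) ∧
  (∀ x ∉ L, ∀ P' : V.Prover, V.acceptProb P' x ≤ ENNReal.ofReal ε)

end Verifier

end WeakIPS

/-! ### The verifier: unary messages checked by random survival. -/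

namespace WeakIPS

/-! Words are numbered injectively by K, and the language becomes the base-8 digits of one real
transition parameter p: for a member, p * 8 ^ K is within 1/4 of an odd natural number; for a
non-member it is at least 3/4 away from every one (`exists_encoding`). In each round the prover
sends, in unary, the numerals of the prefixes of the input, then the powers 8 ^ 0, ..., 8 ^ K, then
an odd number close to p * 8 ^ K. All that has to be checked is that certain real linear
combinations d of block lengths vanish or, for the last one, are small.

A finite automaton cannot store d, but it can let d bias its survival. A round is secretly in
accepting or rejecting mode. An increment e of d is survived with probability exp(-lam * |e|) in
accepting mode and exp(-lam * (|e| + s * e)) in rejecting mode, where s is a secret random sign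
attached to the test. Averaging over s, the odds of rejecting against accepting are multiplied by
cosh(lam * d) for each test, whatever the order of the increments. A round that does not survive is
replayed from the start. At most three tests are open at any time, so three signs suffice.

With honest messages only the last test contributes, by a factor at most cosh(lam / 4). Otherwise
some test has |d| ≥ 3/4, because all tests but the last are integral up to the first failure. Since
cosh(3 * lam / 4) far exceeds cosh(lam / 4), `mix` can be chosen between the two cases. A prover
that never ends a round only prevents halting, which weak acceptance allows. The exact odds come
from `value_go` and `value_finish`; soundness is `accBack_le` and completeness is
`acceptProb_cyclicProver`. -/

/-- The toss of a coin that shows `true` with probability `r` (for `0 ≤ r ≤ 1`). -/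
noncomputable def coin (r : ℝ) : PMF Bool :=
  PMF.ofFintype (fun b => cond b (min (ENNReal.ofReal r) 1) (1 - min (ENNReal.ofReal r) 1)) (by simp)

/-- Messages: a unary digit, the end of a block, and the end of a block that announces the last
power. -/
inductive Msg where
  | tick | sep | jump

/-- What the current block of the message stands for: a numeral of a prefix of the input, a power,
the last power, or the integer part to be tested. -/
inductive Phase where
  | scan | pow | last | fin

instance : Finite Msg :=
  Finite.of_surjective (fun i : Fin 3 => match i with | 0 => Msg.tick | 1 => Msg.sep | 2 => Msg.jump)
    (by rintro (_ | _ | _); exacts [⟨0, rfl⟩, ⟨1, rfl⟩, ⟨2, rfl⟩])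

instance : Finite Phase :=
  Finite.of_surjective (fun i : Fin 4 => match i with
    | 0 => Phase.scan | 1 => Phase.pow | 2 => Phase.last | 3 => Phase.fin)
    (by rintro (_ | _ | _ | _); exacts [⟨0, rfl⟩, ⟨1, rfl⟩, ⟨2, rfl⟩, ⟨3, rfl⟩])

/-- The private part of the state: `none` (the round cannot halt any more), `some none` (the round
will accept) or `some (some s)` (the round will reject), with the signs `s` of the tests. -/
abbrev Hidden := Option (Option (Bool × Bool × Bool))

/-- The parameters of the verifier: `lam` is the scale of the exponents, `p` encodes the
language, `mix` is the probability of the accepting mode, and `base`, `digit` define the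
numeration of words. -/
structure Params (α : Type*) where
  lam : ℝ
  p : ℝ
  mix : ℝ
  base : ℕ
  digit : α → ℕ

/-- Reaction to a message: reject, finish the round, or go on, with the increments of the three
tests. If `shift` holds, the first test is completed and a new one is opened. -/
inductive Action where
  | trap : Action
  | finish : Action
  | go (q : Phase) (mv : Move) (shift : Bool) (e₁ e₂ e₃ : ℝ) : Action

def sgn (b : Bool) : ℝ := cond b 1 (-1)

namespace Params

variable {α : Type*} (π : Params α)

/-- The first test compares the current block with its prescribed length, and the second accumulates
minus the length prescribed for the next block. The third compares the numeral of the whole input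
with the number of powers; it is decremented on entering the power phase and at each later `sep`
there. -/
def action : Phase → Msg → TapeSymbol α → Action
  | .scan, .tick, .letter _ => .go .scan .stay false 1 (-π.base) 0
  | .scan, .tick, .rightEnd => .go .scan .stay false 1 0 1
  | .scan, .sep, .letter a => .go .scan .right true 0 (-π.digit a) 0
  | .scan, .sep, .rightEnd => .go .pow .stay true 0 (-1) (-1)
  | .scan, .jump, .rightEnd => .go .last .stay true 0 (-1) 0
  | .pow, .tick, _ => .go .pow .stay false 1 (-8) 0
  | .pow, .sep, _ => .go .pow .stay true 0 0 (-1)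
  | .pow, .jump, _ => .go .last .stay true 0 0 0
  | .last, .tick, _ => .go .last .stay false 1 (-π.p) 0
  | .last, .sep, _ => .go .fin .stay true 0 1 0
  | .fin, .tick, _ => .go .fin .stay false 2 0 0
  | .fin, .sep, _ => .finish
  | _, _, _ => .trap

/-- On a shift the second test moves to the first place together with its sign, and the newly opened
test gets a fresh sign. -/
noncomputable def hop (shift : Bool) (e₁ e₂ e₃ : ℝ) : Hidden → PMF Hidden
  | none => PMF.pure none
  | some none => (coin (Real.exp (-(π.lam * (|e₁| + |e₂| + |e₃|))))).bind fun z =>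
      if z then PMF.pure (some none) else PMF.pure none
  | some (some (s₁, s₂, s₃)) =>
      (coin (Real.exp (-(π.lam * (|e₁| + |e₂| + |e₃| + (sgn s₁ * e₁ + sgn s₂ * e₂ + sgn s₃ * e₃)))))).bind
        fun z => if z then
          (if shift then (coin (1 / 2)).bind fun b => PMF.pure (some (some (s₂, b, s₃)))
            else PMF.pure (some (some (s₁, s₂, s₃))))
          else PMF.pure none

noncomputable def sample : PMF Hidden :=
  (coin π.mix).bind fun z => if z then PMF.pure (some none) else
    (coin (1 / 2)).bind fun a => (coin (1 / 2)).bind fun b => (coin (1 / 2)).bind fun c =>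
      PMF.pure (some (some (a, b, c)))

/-- The reading states: `none` returns to the left end-marker, and `some (q, η, m)` processes the
message `m`. -/
abbrev Reading := Option (Phase × Hidden × Msg)

def verdict : Hidden → State Reading (Phase × Hidden)
  | none => .read none
  | some none => .accept
  | some (some _) => .reject

noncomputable def react (η : Hidden) : Action → PMF (State Reading (Phase × Hidden) × Move)
  | .trap => PMF.pure (.reject, .stay)
  | .finish => PMF.pure (verdict η, .stay)
  | .go q mv shift e₁ e₂ e₃ => (π.hop shift e₁ e₂ e₃ η).map fun η' => (.comm (q, η'), mv)

noncomputable def delta : Reading → TapeSymbol α → PMF (State Reading (Phase × Hidden) × Move)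
  | none, .leftEnd => π.sample.map fun η => (.comm (.scan, η), .right)
  | none, _ => PMF.pure (.read none, .left)
  | some (q, η, m), σ => π.react η (π.action q m σ)

lemma action_move {q m σ q' mv sh e₁ e₂ e₃} (h : π.action q m σ = .go q' mv sh e₁ e₂ e₃) :
    mv = .stay ∨ (mv = .right ∧ ∃ a, σ = .letter a) := by
  cases q <;> cases m <;> cases σ <;> simp_all [action]

lemma delta_some_move {q η m σ s mv} (h : π.delta (some (q, η, m)) σ (s, mv) ≠ 0) :
    mv = .stay ∨ (mv = .right ∧ ∃ a, σ = .letter a) := by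
  rw [← PMF.mem_support_iff] at h
  simp only [delta] at h
  rcases hA : π.action q m σ with _ | _ | ⟨q', mv', sh, e₁, e₂, e₃⟩ <;> rw [hA] at h
  · simp [react] at h; simp [h]
  · simp [react] at h; simp [h]
  · simp only [react, PMF.support_map, Set.mem_image, Prod.mk.injEq] at h
    obtain ⟨η', -, -, rfl⟩ := h
    exact π.action_move hA

/-- The verifier. -/
noncomputable def verifier : Verifier α where
  R := Reading
  C := Phase × Hidden
  Msg := Msg
  finite_R := inferInstance
  finite_C := inferInstance
  finite_Msg := inferInstance
  start := none
  deltaRead := π.delta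
  -- The written symbol is constant, so the prover learns only how many messages were exchanged, and
  -- its replies do not depend on the private state.
  write _ := .tick
  deltaComm c m := .read (some (c.1, c.2, m))
  not_left r s := by
    rcases r with _ | ⟨q, η, m⟩
    · rw [← not_ne_iff, ← PMF.mem_support_iff]
      simp [delta]
    · by_contra h
      have := π.delta_some_move h
      simp at this
  not_right r s := by
    rcases r with _ | ⟨q, η, m⟩
    · rw [← not_ne_iff, ← PMF.mem_support_iff]
      simp [delta]
    · by_contra h
      have := π.delta_some_move h
      simp at this

end Params

/-! ### The verifier is sweeping. -/

lemma tape_eq_leftEnd {α : Type*} {w : List α} {i : ℕ} : tape w i = .leftEnd ↔ i = 0 := by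
  rcases i with _ | i
  · simp [tape]
  · rcases h : w[i]? with _ | a <;> simp [tape, h]

lemma tape_eq_letter {α : Type*} {w : List α} {i : ℕ} {a : α} (h : tape w i = .letter a) :
    ∃ j, i = j + 1 ∧ w[j]? = some a := by
  rcases i with _ | i
  · simp [tape] at h
  · rcases h' : w[i]? with _ | b <;> simp [tape, h'] at h
    exact ⟨i, rfl, h ▸ h'⟩

lemma tape_eq_rightEnd {α : Type*} {w : List α} {i : ℕ} :
    tape w i = .rightEnd ↔ w.length + 1 ≤ i := by
  rcases i with _ | i
  · simp [tape]
  · rcases h : w[i]? with _ | a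
    · have := List.getElem?_eq_none_iff.1 h
      simp [tape, this]
    · obtain ⟨h', -⟩ := List.getElem?_eq_some_iff.1 h
      simpa [tape, h] using h'

namespace Params

variable {α : Type*} (π : Params α)

/-- The direction of the last non-stationary move. -/
def newDir (d : Move) : Move → Move
  | .left => .left
  | .stay => d
  | .right => .right

/-- The invariant behind the sweeping property. -/
def SweepInv (n : ℕ) : State Reading (Phase × Hidden) → ℕ → Move → Prop
  | .read none, i, d => i = 0 ∨ i = n + 1 ∨ d = .left
  | .read (some (.scan, _, _)), i, d | .comm (.scan, _), i, d => i ≤ n + 1 ∧ d = .right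
  | .read (some _), i, _ | .comm _, i, _ => i = n + 1
  | _, _, _ => True

/-- The head goes right only during `scan`; the later phases are entered on the right end-marker and
stay there, and the return goes left without interruption. -/
lemma sweepInv_step {w : List α} {r i d s m}
    (hr : SweepInv w.length (.read r) i d) (h : π.delta r (tape w i) (s, m) ≠ 0) :
    SweepInv w.length s (m.apply i) (newDir d m) := by
  rw [← PMF.mem_support_iff] at h
  rcases r with _ | ⟨q, η, c⟩
  · rcases hσ : tape w i with _ | a | _ <;> rw [hσ] at h <;> simp [delta] at h
    · obtain ⟨η, -, rfl, rfl⟩ := h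
      rw [tape_eq_leftEnd] at hσ
      subst hσ
      simp [SweepInv, Move.apply, newDir]
    · obtain ⟨rfl, rfl⟩ := h
      simp [SweepInv, newDir]
    · obtain ⟨rfl, rfl⟩ := h
      simp [SweepInv, newDir]
  · have hle : i ≤ w.length + 1 := by cases q <;> simp_all [SweepInv]
    rcases hσ : tape w i with _ | a | _ <;> rw [hσ] at h
    · rw [tape_eq_leftEnd] at hσ
      subst hσ
      cases q <;> cases c <;> simp_all [delta, action, react, SweepInv]
    · obtain ⟨j, rfl, hj⟩ := tape_eq_letter hσ
      obtain ⟨hj, -⟩ := List.getElem?_eq_some_iff.1 hj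
      cases q <;> cases c <;> simp [delta, action, react, SweepInv] at h hr ⊢ <;>
        first
        | (exfalso; omega)
        | (obtain ⟨rfl, rfl⟩ := h; simp)
        | (obtain ⟨η', -, rfl, rfl⟩ := h; simp [Move.apply, newDir, hr]; try omega)
    · rw [tape_eq_rightEnd] at hσ
      obtain rfl : i = w.length + 1 := le_antisymm hle hσ
      cases q <;> cases c <;> simp [delta, action, react, SweepInv] at h hr ⊢ <;>
        first
        | (obtain ⟨rfl, rfl⟩ := h; rcases η with _ | _ | _ <;> simp [verdict, Move.apply, newDir])
        | (obtain ⟨η', -, rfl, rfl⟩ := h; simp [Move.apply, newDir, hr])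

theorem isSweeping_verifier : π.verifier.IsSweeping := by
  have key : ∀ (w : List α) s i d, π.verifier.Reach w s i d → SweepInv w.length s i d := by
    intro w s i d h
    induction h with
    | init => exact Or.inl rfl
    | @comm c i d m _ ih =>
      obtain ⟨q, η⟩ := c
      cases q <;> exact ih
    | stay _ h ih => exact π.sweepInv_step ih h
    | @move r i d m s _ hm h ih =>
      have := π.sweepInv_step ih h
      cases m <;> first | exact this | exact absurd rfl hm
  intro w r i d m s h hδ hm hd
  have hr := key w _ i d h
  rcases r with _ | ⟨q, η, c⟩
  · rcases hr with hr | hr | hr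
    · exact Or.inl hr
    · exact Or.inr hr
    · by_cases hi : i = 0
      · exact Or.inl hi
      · exfalso
        change π.delta none (tape w i) (s, m) ≠ 0 at hδ
        rw [← PMF.mem_support_iff] at hδ
        rcases hσ : tape w i with _ | a | _ <;> rw [hσ] at hδ <;> simp [delta] at hδ
        · exact hi (tape_eq_leftEnd.1 hσ)
        · exact hd ((Prod.mk.inj hδ).2.trans hr.symm)
        · exact hd ((Prod.mk.inj hδ).2.trans hr.symm)
  · rcases π.delta_some_move hδ with rfl | ⟨rfl, a, hσ⟩
    · exact absurd rfl hm
    · cases q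
      · exact absurd hr.2.symm hd
      all_goals exact Or.inr hr

end Params
end WeakIPS

/-! ### Acceptance probabilities within a bounded number of steps. -/

namespace WeakIPS

namespace Verifier

variable {α : Type*} (V : Verifier α) (P : V.Prover) (w : List α)

/-- The probability of acceptance within `t` steps, from a random configuration. -/
noncomputable def accFrom (t : ℕ) (μ : PMF V.Config) : ℝ :=
  (((μ.bind (V.run P w t)).map Config.state) State.accept).toReal

lemma accFrom_nonneg (t : ℕ) (μ : PMF V.Config) : 0 ≤ V.accFrom P w t μ :=
  ENNReal.toReal_nonneg

lemma accFrom_coin {r : ℝ} (h₀ : 0 ≤ r) (h₁ : r ≤ 1) (t : ℕ) (f : Bool → PMF V.Config) :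
    V.accFrom P w t ((coin r).bind f) =
      r * V.accFrom P w t (f true) + (1 - r) * V.accFrom P w t (f false) := by
  have h : ENNReal.ofReal r ≤ 1 := by simpa using h₁
  simp only [accFrom, PMF.bind_bind, PMF.map_bind]
  rw [PMF.bind_apply, tsum_fintype, Fintype.sum_bool]
  simp only [coin, PMF.ofFintype_apply, cond_true, cond_false, min_eq_left h]
  rw [ENNReal.toReal_add (ENNReal.mul_ne_top (by simp) (PMF.apply_ne_top _ _))
      (ENNReal.mul_ne_top (by simp) (PMF.apply_ne_top _ _)),
    ENNReal.toReal_mul, ENNReal.toReal_mul, ENNReal.toReal_ofReal h₀,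
    ENNReal.toReal_sub_of_le h ENNReal.one_ne_top, ENNReal.toReal_ofReal h₀, ENNReal.toReal_one]

lemma accFrom_succ (t : ℕ) (c : V.Config) :
    V.accFrom P w (t + 1) (PMF.pure c) = V.accFrom P w t (V.step P w c) := by
  simp only [accFrom, PMF.pure_bind, run]

lemma accFrom_zero {c : V.Config} (h : c.state ≠ State.accept) :
    V.accFrom P w 0 (PMF.pure c) = 0 := by
  simp [accFrom, run, PMF.pure_map, h.symm]

lemma accFrom_accept (t i : ℕ) (h : List V.Msg) :
    V.accFrom P w t (PMF.pure ⟨State.accept, i, h⟩) = 1 := by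
  induction t with
  | zero => simp [accFrom, run, PMF.pure_map]
  | succ t ih => rw [accFrom_succ]; exact ih

lemma accFrom_reject (t i : ℕ) (h : List V.Msg) :
    V.accFrom P w t (PMF.pure ⟨State.reject, i, h⟩) = 0 := by
  induction t with
  | zero => simp [accFrom, run, PMF.pure_map]
  | succ t ih => rw [accFrom_succ]; exact ih

lemma acceptProb_le {ε : ℝ} (hε : ∀ t, V.accFrom P w t (PMF.pure V.init) ≤ ε) :
    V.acceptProb P w ≤ ENNReal.ofReal ε := by
  refine iSup_le fun t => ?_
  have := hε t
  rw [accFrom, PMF.pure_bind] at this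
  exact (ENNReal.le_ofReal_iff_toReal_le (PMF.apply_ne_top _ _)
    (ENNReal.toReal_nonneg.trans this)).2 this

/-- Only bounds strictly below the limit need be reached in finite time, hence the quantification
over `b`. -/
lemma le_acceptProb {δ : ℝ} (hδ : ∀ b < δ, ∃ t, b ≤ V.accFrom P w t (PMF.pure V.init)) :
    ENNReal.ofReal δ ≤ V.acceptProb P w := by
  have key : ∀ b < δ, ENNReal.ofReal b ≤ V.acceptProb P w := by
    intro b hb
    obtain ⟨t, ht⟩ := hδ b hb
    rw [accFrom, PMF.pure_bind] at ht
    exact ((ENNReal.ofReal_le_ofReal ht).trans ENNReal.ofReal_toReal_le).trans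
      (le_iSup (fun t => ((V.run P w t V.init).map Config.state) State.accept) t)
  refine le_of_tendsto (x := nhdsWithin δ (Set.Iio δ)) (f := ENNReal.ofReal)
    ((ENNReal.continuous_ofReal.tendsto δ).mono_left nhdsWithin_le_nhds) ?_
  filter_upwards [self_mem_nhdsWithin] with b hb using key b hb

end Verifier

/-! ### The exact effect of one message on the acceptance probability. -/

namespace Params

variable {α : Type*} (π : Params α) (P : π.verifier.Prover) (w : List α)

/-- The acceptance probability within `t` steps when the verifier, in phase `q` and with private
state `η`, is about to ask for a message. -/
noncomputable def accAsk (t : ℕ) (q : Phase) (i : ℕ) (h : List Msg) (η : Hidden) : ℝ :=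
  π.verifier.accFrom P w t (PMF.pure ⟨State.comm (q, η), i, h⟩)

/-- The acceptance probability within `t` steps when the verifier is returning to the left
end-marker. -/
noncomputable def accBack (t : ℕ) (i : ℕ) (h : List Msg) : ℝ :=
  π.verifier.accFrom P w t (PMF.pure ⟨State.read none, i, h⟩)

/-- The configuration reached by a reading step. -/
def target (i : ℕ) (h : List Msg) (x : State Reading (Phase × Hidden) × Move) :
    π.verifier.Config := ⟨x.1, x.2.apply i, h⟩

lemma accFrom_target (t : ℕ) (q : Phase) (mv : Move) (i : ℕ) (h : List Msg) (η : Hidden) :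
    π.verifier.accFrom P w t (PMF.pure (π.target i h (State.comm (q, η), mv))) =
      π.accAsk P w t q (mv.apply i) h η := rfl

/-- The next message of the prover. -/
def reply (h : List Msg) : Msg := P w (h ++ [Msg.tick])

lemma accAsk_add_two (t : ℕ) (q : Phase) (i : ℕ) (h : List Msg) (η : Hidden) :
    π.accAsk P w (t + 2) q i h η = π.verifier.accFrom P w t
      ((π.react η (π.action q (π.reply P w h) (tape w i))).map (π.target i (h ++ [Msg.tick]))) := by
  rw [accAsk, Verifier.accFrom_succ]
  change π.verifier.accFrom P w (t + 1) (PMF.pure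
    ⟨State.read (some (q, η, π.reply P w h)), i, h ++ [Msg.tick]⟩) = _
  rw [Verifier.accFrom_succ]
  rfl

lemma accAsk_zero (q : Phase) (i : ℕ) (h : List Msg) (η : Hidden) : π.accAsk P w 0 q i h η = 0 :=
  π.verifier.accFrom_zero P w (by simp)

lemma accAsk_one (q : Phase) (i : ℕ) (h : List Msg) (η : Hidden) : π.accAsk P w 1 q i h η = 0 := by
  rw [accAsk, Verifier.accFrom_succ]
  exact π.verifier.accFrom_zero P w (c := ⟨State.read (some (q, η, π.reply P w h)), i, _⟩) (by simp)

lemma accBack_zero (i : ℕ) (h : List Msg) : π.accBack P w 0 i h = 0 :=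
  π.verifier.accFrom_zero P w (by simp)

lemma accBack_succ_succ (t i : ℕ) (h : List Msg) :
    π.accBack P w (t + 1) (i + 1) h = π.accBack P w t i h := by
  rw [accBack, Verifier.accFrom_succ]
  change π.verifier.accFrom P w t ((π.delta none (tape w (i + 1))).map (π.target (i + 1) h)) = _
  have : π.delta none (tape w (i + 1)) = PMF.pure (.read none, .left) := by
    rcases hσ : tape w (i + 1) with _ | _ | _
    · simp [tape_eq_leftEnd] at hσ
    · rfl
    · rfl
  rw [this, PMF.pure_map]
  rfl

lemma accBack_add (t i : ℕ) (h : List Msg) :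
    π.accBack P w (t + i) i h = π.accBack P w t 0 h := by
  induction i with
  | zero => rfl
  | succ i ih => rw [← add_assoc, accBack_succ_succ, ih]

lemma accAsk_trap {q : Phase} {i : ℕ} {h : List Msg}
    (hA : π.action q (π.reply P w h) (tape w i) = .trap) (t : ℕ) (η : Hidden) :
    π.accAsk P w (t + 2) q i h η = 0 := by
  rw [accAsk_add_two, hA, react, PMF.pure_map]
  exact π.verifier.accFrom_reject P w t _ _

lemma accAsk_finish {q : Phase} {i : ℕ} {h : List Msg}
    (hA : π.action q (π.reply P w h) (tape w i) = .finish) (t : ℕ) (η : Hidden) :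
    π.accAsk P w (t + 2) q i h η = match η with
      | none => π.accBack P w t i (h ++ [Msg.tick])
      | some none => 1
      | some (some _) => 0 := by
  rw [accAsk_add_two, hA, react, PMF.pure_map]
  rcases η with _ | _ | s
  · rfl
  · exact π.verifier.accFrom_accept P w t _ _
  · exact π.verifier.accFrom_reject P w t _ _

/-- The advantage over a round that cannot halt any more. -/
noncomputable def gain (t : ℕ) (q : Phase) (i : ℕ) (h : List Msg) (η : Option (Bool × Bool × Bool)) :
    ℝ := π.accAsk P w t q i h (some η) - π.accAsk P w t q i h none

variable {π P w}

lemma abs_add_sgn_mul_nonneg (s : Bool) (e : ℝ) : 0 ≤ |e| + sgn s * e := by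
  cases s
  · simpa [sgn] using le_abs_self e
  · simpa [sgn, neg_le_iff_add_nonneg'] using neg_abs_le e

section Go

variable {q q' : Phase} {i : ℕ} {h : List Msg} {mv : Move} {sh : Bool} {e₁ e₂ e₃ : ℝ}
  (hlam : 0 ≤ π.lam)
  (hA : π.action q (π.reply P w h) (tape w i) = .go q' mv sh e₁ e₂ e₃) (t : ℕ)

include hA in
lemma accAsk_go_none : π.accAsk P w (t + 2) q i h none =
    π.accAsk P w t q' (mv.apply i) (h ++ [Msg.tick]) none := by
  rw [accAsk_add_two, hA, react, hop, PMF.pure_map, PMF.pure_map]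
  rfl

-- Failing the survival toss leads to the private state `none`, whose gain is zero by definition;
-- hence the gain is simply multiplied by the survival probability.
include hlam hA in
lemma gain_go_none : π.gain P w (t + 2) q i h none =
    Real.exp (-(π.lam * (|e₁| + |e₂| + |e₃|))) *
      π.gain P w t q' (mv.apply i) (h ++ [Msg.tick]) none := by
  rw [gain, accAsk_go_none hA, accAsk_add_two, hA, react, hop, PMF.map_bind, PMF.map_bind,
    Verifier.accFrom_coin _ _ _ (Real.exp_nonneg _)
      (Real.exp_le_one_iff.2 (neg_nonpos.2 (by positivity)))]
  simp only [if_true, Bool.false_eq_true, if_false, PMF.pure_map, gain, accFrom_target]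
  ring

include hlam hA in
lemma gain_go_some (s₁ s₂ s₃ : Bool) : π.gain P w (t + 2) q i h (some (s₁, s₂, s₃)) =
    Real.exp (-(π.lam * (|e₁| + |e₂| + |e₃| + (sgn s₁ * e₁ + sgn s₂ * e₂ + sgn s₃ * e₃)))) *
      if sh then (π.gain P w t q' (mv.apply i) (h ++ [Msg.tick]) (some (s₂, true, s₃)) +
          π.gain P w t q' (mv.apply i) (h ++ [Msg.tick]) (some (s₂, false, s₃))) / 2
        else π.gain P w t q' (mv.apply i) (h ++ [Msg.tick]) (some (s₁, s₂, s₃)) := by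
  have hw : 0 ≤ |e₁| + |e₂| + |e₃| + (sgn s₁ * e₁ + sgn s₂ * e₂ + sgn s₃ * e₃) := by
    linarith [abs_add_sgn_mul_nonneg s₁ e₁, abs_add_sgn_mul_nonneg s₂ e₂,
      abs_add_sgn_mul_nonneg s₃ e₃]
  rw [gain, accAsk_go_none hA, accAsk_add_two, hA, react, hop, PMF.map_bind, PMF.map_bind,
    Verifier.accFrom_coin _ _ _ (Real.exp_nonneg _)
      (Real.exp_le_one_iff.2 (neg_nonpos.2 (mul_nonneg hlam hw)))]
  cases sh
  · simp only [if_true, Bool.false_eq_true, if_false, PMF.pure_map, gain, accFrom_target]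
    ring
  · simp only [if_true, Bool.false_eq_true, if_false, PMF.map_bind, PMF.pure_map, gain]
    rw [Verifier.accFrom_coin _ _ _ (by norm_num) (by norm_num)]
    simp only [accFrom_target]
    ring

end Go

/-- The state of knowledge about a round: the phase, the position of the head, the three
discrepancies of the tests, the probability `X` of surviving in the accepting mode, and the factor
`C` contributed by the completed tests. -/
structure Ledger where
  q : Phase
  i : ℕ
  d₁ : ℝ
  d₂ : ℝ
  d₃ : ℝ
  X : ℝ
  C : ℝ

-- When a test is completed, its sign is averaged out and leaves a factor cosh in `C`.
variable (π) in
noncomputable def Ledger.next (g : Ledger) (q' : Phase) (mv : Move) (sh : Bool) (e₁ e₂ e₃ : ℝ) : Ledger where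
  q := q'
  i := mv.apply g.i
  d₁ := if sh then g.d₂ + e₂ else g.d₁ + e₁
  d₂ := if sh then 0 else g.d₂ + e₂
  d₃ := g.d₃ + e₃
  X := g.X * Real.exp (-(π.lam * (|e₁| + |e₂| + |e₃|)))
  C := if sh then g.C * Real.cosh (π.lam * (g.d₁ + e₁)) else g.C

variable (π P w)

/-- The acceptance probability within `t` steps, for the distribution of the private state
described by a ledger. -/
noncomputable def value (t : ℕ) (g : Ledger) (h : List Msg) : ℝ :=
  π.accAsk P w t g.q g.i h none + g.X * (π.mix * π.gain P w t g.q g.i h none +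
    (1 - π.mix) / 8 * g.C * ∑ s₁ : Bool, ∑ s₂ : Bool, ∑ s₃ : Bool,
      Real.exp (-(π.lam * (sgn s₁ * g.d₁ + sgn s₂ * g.d₂ + sgn s₃ * g.d₃))) *
        π.gain P w t g.q g.i h (some (s₁, s₂, s₃)))

def Ledger.initial : Ledger := ⟨.scan, 1, 0, 0, 0, 1, 1⟩

variable {π P w}

/-- The prover's reply is the same for all private states, so the whole distribution moves along and
remains of the form described by a ledger. -/
lemma value_go (hlam : 0 ≤ π.lam) {g : Ledger} {h : List Msg} {q' mv sh e₁ e₂ e₃}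
    (hA : π.action g.q (π.reply P w h) (tape w g.i) = .go q' mv sh e₁ e₂ e₃) (t : ℕ) :
    π.value P w (t + 2) g h =
      π.value P w t (g.next π q' mv sh e₁ e₂ e₃) (h ++ [Msg.tick]) := by
  simp only [value, accAsk_go_none hA, gain_go_none hlam hA, gain_go_some hlam hA, Ledger.next]
  generalize π.accAsk P w t q' (mv.apply g.i) (h ++ [Msg.tick]) none = z
  generalize π.gain P w t q' (mv.apply g.i) (h ++ [Msg.tick]) = G
  -- The factor common to both modes splits off, and the signed parts of the exponents add up to the
  -- new discrepancies.
  have hE : ∀ s₁ s₂ s₃ (Y : ℝ), Real.exp (-(π.lam * (sgn s₁ * g.d₁ + sgn s₂ * g.d₂ + sgn s₃ * g.d₃))) *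
      (Real.exp (-(π.lam * (|e₁| + |e₂| + |e₃| + (sgn s₁ * e₁ + sgn s₂ * e₂ + sgn s₃ * e₃)))) * Y) =
      Real.exp (-(π.lam * (|e₁| + |e₂| + |e₃|))) * (Real.exp (-(π.lam * (sgn s₁ * (g.d₁ + e₁) +
        sgn s₂ * (g.d₂ + e₂) + sgn s₃ * (g.d₃ + e₃)))) * Y) := by
    intro s₁ s₂ s₃ Y
    rw [← mul_assoc, ← mul_assoc, ← Real.exp_add, ← Real.exp_add]
    ring_nf
  simp only [hE]
  generalize Real.exp (-(π.lam * (|e₁| + |e₂| + |e₃|))) = E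
  generalize g.d₁ + e₁ = D₁
  generalize g.d₂ + e₂ = D₂
  generalize g.d₃ + e₃ = D₃
  cases sh
  · simp only [Bool.false_eq_true, if_false, Fintype.sum_bool]
    ring
  · simp only [if_true, Fintype.sum_bool, sgn, cond_true, cond_false, mul_add, Real.cosh_eq,
      one_mul, neg_mul, neg_add, mul_neg, neg_neg, mul_zero, add_zero, Real.exp_add]
    ring

/-- A surviving accepting round gains 1 - z over a replay of value z, and a surviving rejecting
round loses z; summing over the three signs yields the three cosines. -/
lemma value_finish {g : Ledger} {h : List Msg}
    (hA : π.action g.q (π.reply P w h) (tape w g.i) = .finish) (t : ℕ) :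
    π.value P w (t + 2) g h = π.accBack P w t g.i (h ++ [Msg.tick]) +
      g.X * (π.mix * (1 - π.accBack P w t g.i (h ++ [Msg.tick])) -
        (1 - π.mix) * (g.C * Real.cosh (π.lam * g.d₁) * Real.cosh (π.lam * g.d₂) *
          Real.cosh (π.lam * g.d₃)) * π.accBack P w t g.i (h ++ [Msg.tick])) := by
  simp only [value, gain, accAsk_finish π P w hA]
  generalize π.accBack P w t g.i (h ++ [Msg.tick]) = z
  simp only [Fintype.sum_bool, sgn, cond_true, cond_false, mul_add, Real.cosh_eq,
      one_mul, neg_mul, neg_add, mul_neg, neg_neg, Real.exp_add]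
  ring

lemma value_trap {g : Ledger} {h : List Msg}
    (hA : π.action g.q (π.reply P w h) (tape w g.i) = .trap) (t : ℕ) :
    π.value P w (t + 2) g h = 0 := by
  simp [value, gain, accAsk_trap π P w hA]

lemma value_zero (g : Ledger) (h : List Msg) : π.value P w 0 g h = 0 := by
  simp [value, gain, accAsk_zero]

lemma value_one (g : Ledger) (h : List Msg) : π.value P w 1 g h = 0 := by
  simp [value, gain, accAsk_one]

lemma accBack_succ_zero (hm₀ : 0 ≤ π.mix) (hm₁ : π.mix ≤ 1) (t : ℕ) (h : List Msg) :
    π.accBack P w (t + 1) 0 h = π.value P w t .initial h := by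
  rw [accBack, Verifier.accFrom_succ]
  change π.verifier.accFrom P w t ((π.sample.map fun η => (.comm (.scan, η), .right)).map
    (π.target 0 h)) = _
  rw [sample, PMF.map_bind, PMF.map_bind, Verifier.accFrom_coin _ _ _ hm₀ hm₁]
  simp only [if_true, Bool.false_eq_true, if_false, PMF.map_bind, PMF.pure_map]
  simp only [Verifier.accFrom_coin π.verifier P w (r := 1 / 2) (by norm_num) (by norm_num)]
  simp only [accFrom_target]
  simp only [value, gain, Ledger.initial, Move.apply, Fintype.sum_bool, mul_zero,
    add_zero, neg_zero, Real.exp_zero, Nat.zero_add]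
  ring

end Params
end WeakIPS

/-! ### Encoding the language in a real number. -/

namespace WeakIPS

/-- Every set of natural numbers is encoded in the digits of a real number: for `k ∈ S` the number
`p * 8 ^ k` is close to an odd natural number, and for `k ∉ S` it is not. -/
lemma exists_encoding (S : Set ℕ) : ∃ p : ℝ,
    (∀ k ∈ S, ∃ m : ℕ, |2 * (m : ℝ) + 1 - p * 8 ^ k| ≤ 1 / 4) ∧
    ∀ k ∉ S, ∀ m : ℕ, 3 / 4 ≤ |2 * (m : ℝ) + 1 - p * 8 ^ k| := by
  classical
  let b : ℕ → ℝ := fun k => if k ∈ S then 1 else 0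
  have hb₀ : ∀ k, 0 ≤ b k := fun k => by by_cases h : k ∈ S <;> simp [b, h]
  have hb₁ : ∀ k, b k ≤ 1 := fun k => by by_cases h : k ∈ S <;> simp [b, h]
  have hg : Summable fun k : ℕ => ((1 / 8 : ℝ)) ^ k :=
    summable_geometric_of_lt_one (by norm_num) (by norm_num)
  have hs : Summable fun k => b k * (1 / 8 : ℝ) ^ k :=
    hg.of_nonneg_of_le (fun k => mul_nonneg (hb₀ k) (by positivity))
      fun k => mul_le_of_le_one_left (by positivity) (hb₁ k)
  have key : ∀ k, ∃ N : ℕ, ∃ τ : ℝ, 0 ≤ τ ∧ τ ≤ 1 / 4 ∧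
      (∑' k, b k * (1 / 8 : ℝ) ^ k) * 8 ^ k = 2 * (N : ℝ) + b k + τ := by
    intro k
    have hhead : ∀ k, ∃ N : ℕ, (∑ j ∈ Finset.range k, b j * (1 / 8 : ℝ) ^ j) * 8 ^ k = 2 * (N : ℝ) := by
      intro k
      induction k with
      | zero => exact ⟨0, by simp⟩
      | succ k ih =>
        obtain ⟨N, hN⟩ := ih
        -- Multiplication by 8 makes the old digit contribute 8 * b k, so the head of the expansion
        -- stays even.
        refine ⟨8 * N + 4 * (if k ∈ S then 1 else 0), ?_⟩
        have h8 : (1 / 8 : ℝ) ^ k * 8 ^ k = 1 := by rw [← mul_pow]; norm_num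
        rw [Finset.sum_range_succ, pow_succ]
        push_cast
        calc (∑ j ∈ Finset.range k, b j * (1 / 8 : ℝ) ^ j + b k * (1 / 8) ^ k) * (8 ^ k * 8)
            = 8 * ((∑ j ∈ Finset.range k, b j * (1 / 8 : ℝ) ^ j) * 8 ^ k) +
              8 * b k * ((1 / 8) ^ k * 8 ^ k) := by ring
          _ = _ := by rw [hN, h8]; ring
    obtain ⟨N, hN⟩ := hhead k
    -- The scaled tail is at most 1/8 + 1/64 + ... = 1/7.
    refine ⟨N, (∑' j, b (j + (k + 1)) * (1 / 8 : ℝ) ^ (j + (k + 1))) * 8 ^ k, ?_, ?_, ?_⟩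
    · exact mul_nonneg (tsum_nonneg fun j => mul_nonneg (hb₀ _) (by positivity)) (by positivity)
    · rw [← tsum_mul_right]
      have h8 : ∀ j, (1 / 8 : ℝ) ^ (j + (k + 1)) * 8 ^ k = (1 / 8) ^ j * (1 / 8) := by
        intro j
        have : (1 / 8 : ℝ) ^ k * 8 ^ k = 1 := by rw [← mul_pow]; norm_num
        calc (1 / 8 : ℝ) ^ (j + (k + 1)) * 8 ^ k = (1 / 8) ^ j * (1 / 8) * ((1 / 8) ^ k * 8 ^ k) := by
              ring
          _ = _ := by rw [this, mul_one]
      have hle : ∀ j, b (j + (k + 1)) * (1 / 8 : ℝ) ^ (j + (k + 1)) * 8 ^ k ≤ (1 / 8) ^ j * (1 / 8) := by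
        intro j
        rw [mul_assoc, h8]
        exact mul_le_of_le_one_left (by positivity) (hb₁ _)
      calc _ ≤ ∑' j : ℕ, (1 / 8 : ℝ) ^ j * (1 / 8) :=
            Summable.tsum_le_tsum hle
              (((summable_nat_add_iff (k + 1)).2 hs).mul_right _) (hg.mul_right _)
        _ = (1 - 1 / 8)⁻¹ * (1 / 8) := by
            rw [tsum_mul_right, tsum_geometric_of_lt_one (by norm_num) (by norm_num)]
        _ ≤ 1 / 4 := by norm_num
    · have h8 : (1 / 8 : ℝ) ^ k * 8 ^ k = 1 := by rw [← mul_pow]; norm_num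
      rw [← hs.sum_add_tsum_nat_add (k + 1), Finset.sum_range_succ, add_mul, add_mul, hN, mul_assoc,
        h8, mul_one]
  refine ⟨∑' k, b k * (1 / 8 : ℝ) ^ k, fun k hk => ?_, fun k hk m => ?_⟩
  · obtain ⟨N, τ, h₀, h₁, h⟩ := key k
    refine ⟨N, ?_⟩
    rw [h, abs_le]
    simp only [b, if_pos hk]
    constructor <;> linarith
  · obtain ⟨N, τ, h₀, h₁, h⟩ := key k
    rw [h]
    simp only [b, if_neg hk, add_zero]
    rw [le_abs]
    rcases le_or_gt N m with hm | hm
    · left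
      have : (N : ℝ) ≤ m := by exact_mod_cast hm
      linarith
    · right
      have : (m : ℝ) + 1 ≤ N := by exact_mod_cast hm
      linarith

/-! ### Numerals of words. -/

namespace Params

variable {α : Type*} (π : Params α)

/-- The number denoted by a word. -/
def numeral (w : List α) : ℕ := w.foldl (fun k a => π.base * k + π.digit a) 0

lemma numeral_append_singleton (w : List α) (a : α) :
    π.numeral (w ++ [a]) = π.base * π.numeral w + π.digit a := by
  simp [numeral]

/-- Zero is not a digit, so words of different lengths cannot share a numeral; the last letter is
recovered modulo the base. -/
lemma numeral_injective (hinj : Function.Injective π.digit) (hpos : ∀ a, 0 < π.digit a)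
    (hlt : ∀ a, π.digit a < π.base) : Function.Injective π.numeral := by
  intro v
  induction v using List.reverseRecOn with
  | nil =>
    intro w h
    rcases List.eq_nil_or_concat' w with rfl | ⟨w, a, rfl⟩
    · rfl
    · rw [numeral_append_singleton] at h
      have := hpos a
      simp [numeral] at h
      omega
  | append_singleton v a ih =>
    intro w h
    rcases List.eq_nil_or_concat' w with rfl | ⟨w, c, rfl⟩
    · rw [numeral_append_singleton] at h
      have := hpos a
      simp [numeral] at h
      omega
    · simp only [numeral_append_singleton] at h
      have hmod := congrArg (· % π.base) h
      simp only [Nat.mul_add_mod, Nat.mod_eq_of_lt (hlt _)] at hmod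
      obtain rfl := hinj hmod
      rw [ih (Nat.eq_of_mul_eq_mul_left ((hpos a).trans (hlt a)) (Nat.add_right_cancel h))]

/-! ### Soundness against every prover. -/

/-- The discrepancies of a round in which all the completed tests were passed. -/
inductive Correct (w : List α) : Phase → ℕ → ℝ → ℝ → ℝ → Prop
  | scan {d₁ d₂ d₃ : ℝ} (j u : ℕ) : j < w.length → d₁ = u - π.numeral (w.take j) →
      d₂ = -(π.base * u) → d₃ = 0 → Correct w .scan (j + 1) d₁ d₂ d₃
  | edge {d₁ d₂ d₃ : ℝ} (u : ℕ) : d₁ = u - π.numeral w → d₂ = 0 → d₃ = u →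
      Correct w .scan (w.length + 1) d₁ d₂ d₃
  | pow {d₁ d₂ d₃ : ℝ} (i j u : ℕ) : d₁ = u - 8 ^ j → d₂ = -(8 * u) →
      d₃ = π.numeral w - (j + 1) → Correct w .pow i d₁ d₂ d₃
  | last {d₁ d₂ d₃ : ℝ} (i j u : ℕ) : d₁ = u - 8 ^ j → d₂ = -(π.p * u) →
      d₃ = π.numeral w - j → Correct w .last i d₁ d₂ d₃
  | fin {d₁ d₂ d₃ : ℝ} (i j u : ℕ) : d₁ = 2 * u + 1 - π.p * 8 ^ j → d₂ = 0 →
      d₃ = π.numeral w - j → Correct w .fin i d₁ d₂ d₃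

variable {π} {w : List α}

lemma tape_length_add_one : tape w (w.length + 1) = .rightEnd := tape_eq_rightEnd.2 le_rfl

lemma tape_succ_of_lt {j : ℕ} (hj : j < w.length) : tape w (j + 1) = .letter w[j] := by
  simp [tape, hj]

lemma correct_scan {j : ℕ} (hj : j ≤ w.length) {d₁ : ℝ} (hd : d₁ = -π.numeral (w.take j)) :
    Correct π w .scan (j + 1) d₁ 0 0 := by
  rcases hj.lt_or_eq with hj | rfl
  · exact .scan j 0 hj (by simp [hd]) (by simp) rfl
  · exact .edge 0 (by simpa using hd) rfl (by simp)

lemma one_le_abs_natCast_sub {u v : ℕ} (h : u ≠ v) : (1 : ℝ) ≤ |(u : ℝ) - v| := by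
  have : (1 : ℤ) ≤ |(u : ℤ) - v| := Int.one_le_abs (by omega)
  exact_mod_cast this

/-- A test is completed only with an integral discrepancy, and if it is `0`, the round remains
correct. -/
lemma Correct.go {m q q' i d₁ d₂ d₃ mv sh e₁ e₂ e₃} (hc : Correct π w q i d₁ d₂ d₃)
    (hA : π.action q m (tape w i) = .go q' mv sh e₁ e₂ e₃) :
    (sh = true ∧ 1 ≤ |d₁ + e₁|) ∨ Correct π w q' (mv.apply i)
      (if sh then d₂ + e₂ else d₁ + e₁) (if sh then 0 else d₂ + e₂) (d₃ + e₃) := by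
  rcases hc with ⟨j, u, hj, rfl, rfl, rfl⟩ | ⟨u, rfl, rfl, rfl⟩ | ⟨i, j, u, rfl, rfl, rfl⟩ |
    ⟨i, j, u, rfl, rfl, rfl⟩ | ⟨i, j, u, rfl, rfl, rfl⟩
  · rw [tape_succ_of_lt hj] at hA
    cases m <;> simp only [action, Action.go.injEq, reduceCtorEq] at hA
    · obtain ⟨rfl, rfl, rfl, rfl, rfl, rfl⟩ := hA
      exact .inr (.scan j (u + 1) hj (by push_cast; ring) (by push_cast; ring) (by simp))
    · obtain ⟨rfl, rfl, rfl, rfl, rfl, rfl⟩ := hA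
      by_cases hu : u = π.numeral (w.take j)
      · right
        simp only [if_true, add_zero, Move.apply]
        refine correct_scan hj ?_
        rw [List.take_add_one, List.getElem?_eq_getElem hj, Option.toList_some,
          numeral_append_singleton, ← hu]
        push_cast
        ring
      · exact .inl ⟨rfl, by simpa using one_le_abs_natCast_sub hu⟩
  · rw [tape_length_add_one] at hA
    cases m <;> simp only [action, Action.go.injEq] at hA
    · obtain ⟨rfl, rfl, rfl, rfl, rfl, rfl⟩ := hA
      exact .inr (.edge (u + 1) (by push_cast; ring) (by simp) (by push_cast; simp))
    all_goals
      obtain ⟨rfl, rfl, rfl, rfl, rfl, rfl⟩ := hA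
      by_cases hu : u = π.numeral w
    · exact .inr (.pow _ 0 0 (by simp) (by simp) (by simp [hu, sub_eq_add_neg]))
    · exact .inl ⟨rfl, by simpa using one_le_abs_natCast_sub hu⟩
    · exact .inr (.last _ 0 0 (by simp) (by simp) (by simp [hu]))
    · exact .inl ⟨rfl, by simpa using one_le_abs_natCast_sub hu⟩
  · cases m <;> simp only [action, Action.go.injEq] at hA
    · obtain ⟨rfl, rfl, rfl, rfl, rfl, rfl⟩ := hA
      exact .inr (.pow _ j (u + 1) (by push_cast; ring) (by push_cast; ring) (by simp))
    all_goals
      obtain ⟨rfl, rfl, rfl, rfl, rfl, rfl⟩ := hA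
      by_cases hu : u = 8 ^ j
    · exact .inr (.pow _ (j + 1) 0 (by simp [hu]; ring) (by simp) (by push_cast; ring))
    · exact .inl ⟨rfl, by simpa using one_le_abs_natCast_sub hu⟩
    · exact .inr (.last _ (j + 1) 0 (by simp [hu]; ring) (by simp) (by push_cast; ring))
    · exact .inl ⟨rfl, by simpa using one_le_abs_natCast_sub hu⟩
  · cases m <;> simp only [action, Action.go.injEq, reduceCtorEq] at hA
    · obtain ⟨rfl, rfl, rfl, rfl, rfl, rfl⟩ := hA
      exact .inr (.last _ j (u + 1) (by push_cast; ring) (by push_cast; ring) (by simp))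
    · obtain ⟨rfl, rfl, rfl, rfl, rfl, rfl⟩ := hA
      by_cases hu : u = 8 ^ j
      · exact .inr (.fin _ j 0 (by simp [hu]; ring) (by simp) (by simp))
      · exact .inl ⟨rfl, by simpa using one_le_abs_natCast_sub hu⟩
  · cases m <;> simp only [action, Action.go.injEq, reduceCtorEq] at hA
    obtain ⟨rfl, rfl, rfl, rfl, rfl, rfl⟩ := hA
    exact .inr (.fin _ j (u + 1) (by push_cast; ring) (by simp) (by simp))

variable (π) in
/-- The probability of surviving is positive, and small after the scan of the input. -/
def SmallX (g : Ledger) : Prop := 0 < g.X ∧ g.X ≤ 1 ∧ (g.q ≠ .scan → g.X ≤ Real.exp (-π.lam))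

lemma SmallX.go (hlam : 0 ≤ π.lam) {g : Ledger} (hg : SmallX π g) {m q' mv sh e₁ e₂ e₃ σ}
    (hA : π.action g.q m σ = .go q' mv sh e₁ e₂ e₃) :
    SmallX π (g.next π q' mv sh e₁ e₂ e₃) := by
  obtain ⟨h₀, h₁, h₂⟩ := hg
  have hle : Real.exp (-(π.lam * (|e₁| + |e₂| + |e₃|))) ≤ 1 :=
    Real.exp_le_one_iff.2 (neg_nonpos.2 (by positivity))
  refine ⟨mul_pos h₀ (Real.exp_pos _), mul_le_one₀ h₁ (Real.exp_nonneg _) hle, fun hq => ?_⟩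
  by_cases hs : g.q = .scan
  · have h1 : 1 ≤ |e₁| + |e₂| + |e₃| := by
      rw [hs] at hA
      cases m <;> cases σ <;> simp only [action, Action.go.injEq, reduceCtorEq] at hA <;>
        obtain ⟨rfl, rfl, rfl, rfl, rfl, rfl⟩ := hA <;> simp [Ledger.next] at hq ⊢
    calc g.X * Real.exp (-(π.lam * (|e₁| + |e₂| + |e₃|)))
        ≤ 1 * Real.exp (-(π.lam * (|e₁| + |e₂| + |e₃|))) := by gcongr
      _ ≤ Real.exp (-π.lam) := by
        rw [one_mul, Real.exp_le_exp, neg_le_neg_iff]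
        exact le_mul_of_one_le_right hlam h1
  · exact (mul_le_of_le_one_right h₀.le hle).trans (h₂ hs)

lemma smallX_initial : SmallX π .initial := ⟨one_pos, le_rfl, fun h => absurd rfl h⟩

lemma action_eq_finish {q m σ} (h : π.action q m σ = .finish) : q = .fin := by
  cases q <;> cases m <;> cases σ <;> simp_all [action]

lemma le_mul_of_one_le_of_le {T a b : ℝ} (ha : 1 ≤ a) (hb : 0 ≤ b) (h : T ≤ b) : T ≤ a * b :=
  h.trans (le_mul_of_one_le_left hb ha)

/-- Against any prover, a word whose code is far from odd numbers is accepted with probability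
at most `ε`. -/
theorem accBack_le {ε T : ℝ} (hε₀ : 0 < ε) (hlam : 0 ≤ π.lam) (hm₀ : 0 ≤ π.mix) (hm₁ : π.mix ≤ 1)
    (hT : ∀ d, 3 / 4 ≤ |d| → T ≤ Real.cosh (π.lam * d)) (hX : Real.exp (-π.lam) ≤ ε)
    (hmix : π.mix * (1 - ε) ≤ (1 - π.mix) * T * ε)
    (hp : ∀ m : ℕ, 3 / 4 ≤ |2 * (m : ℝ) + 1 - π.p * 8 ^ π.numeral w|)
    (P : π.verifier.Prover) (t i : ℕ) (h : List Msg) : π.accBack P w t i h ≤ ε := by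
  -- Inside a round, either a failed test has already brought `C` up to `T`, or everything completed
  -- so far is correct.
  have key : ∀ t, (∀ i h, π.accBack P w t i h ≤ ε) ∧ ∀ g h, SmallX π g → 1 ≤ g.C →
      (T ≤ g.C ∨ Correct π w g.q g.i g.d₁ g.d₂ g.d₃) → π.value P w t g h ≤ ε := by
    intro t
    induction t using Nat.strong_induction_on with
    | _ t ih =>
    refine ⟨fun i h => ?_, fun g h hX' hC hc => ?_⟩
    · rcases t with _ | t
      · rw [accBack_zero]; exact hε₀.le
      · rcases i with _ | i
        · rw [accBack_succ_zero hm₀ hm₁]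
          exact (ih t t.lt_succ_self).2 _ _ smallX_initial le_rfl
            (.inr (correct_scan (Nat.zero_le _) (by simp [Ledger.initial, numeral])))
        · rw [accBack_succ_succ]
          exact (ih t t.lt_succ_self).1 _ _
    · rcases t with _ | _ | t
      · rw [value_zero]; exact hε₀.le
      · rw [value_one]; exact hε₀.le
      · rcases hA : π.action g.q (π.reply P w h) (tape w g.i) with _ | _ | ⟨q', mv, sh, e₁, e₂, e₃⟩
        · rw [value_trap hA]; exact hε₀.le
        · rw [value_finish hA]
          have hz₀ : 0 ≤ π.accBack P w t g.i (h ++ [Msg.tick]) := Verifier.accFrom_nonneg _ _ _ _ _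
          have hz₁ := (ih t (by omega)).1 g.i (h ++ [Msg.tick])
          generalize π.accBack P w t g.i (h ++ [Msg.tick]) = z at hz₀ hz₁
          have hq := action_eq_finish hA
          have h1 := Real.one_le_cosh (π.lam * g.d₁)
          have h2 := Real.one_le_cosh (π.lam * g.d₂)
          have h3 := Real.one_le_cosh (π.lam * g.d₃)
          have hQ : T ≤ g.C * Real.cosh (π.lam * g.d₁) * Real.cosh (π.lam * g.d₂) *
              Real.cosh (π.lam * g.d₃) := by
            have hC1 : 1 ≤ g.C * Real.cosh (π.lam * g.d₁) := one_le_mul_of_one_le_of_one_le hC h1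
            have hC2 := one_le_mul_of_one_le_of_one_le hC1 h2
            rcases hc with hc | hc
            · refine hc.trans ?_
              rw [mul_assoc, mul_assoc]
              exact le_mul_of_one_le_right (by linarith)
                (one_le_mul_of_one_le_of_one_le h1 (one_le_mul_of_one_le_of_one_le h2 h3))
            · generalize g.d₁ = d₁ at *
              generalize g.d₂ = d₂ at *
              generalize g.d₃ = d₃ at *
              rw [hq] at hc
              rcases hc with _ | _ | _ | _ | ⟨_, j, u, rfl, rfl, rfl⟩
              -- With the right exponent, the final test is far from zero by the encoding; with a
              -- wrong one, the third test is off by at least 1.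
              by_cases hj : π.numeral w = j
              · have := hT _ (hp u)
                rw [hj] at this
                refine (this.trans ?_).trans (le_mul_of_one_le_right (by linarith) h3)
                refine le_trans ?_ (le_mul_of_one_le_right (by linarith) h2)
                exact le_mul_of_one_le_left (by linarith) hC
              · refine le_mul_of_one_le_of_le hC2 (by linarith) (hT _ ?_)
                linarith [one_le_abs_natCast_sub hj]
          generalize g.C * Real.cosh (π.lam * g.d₁) * Real.cosh (π.lam * g.d₂) *
              Real.cosh (π.lam * g.d₃) = Q at hQ
          -- The bound on `X` handles the end z = 0, where every later round is worthless; the odds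
          -- handle the end z = ε.
          have hXε : g.X ≤ ε := (hX'.2.2 (by simp [hq])).trans hX
          have hX0 := hX'.1
          have hXm : g.X * π.mix ≤ ε := (mul_le_of_le_one_right hX0.le hm₁).trans hXε
          have hr : π.mix * (1 - ε) ≤ (1 - π.mix) * Q * ε :=
            hmix.trans (by have := sub_nonneg.2 hm₁; gcongr)
          have hr' := mul_le_mul_of_nonneg_left hr hX0.le
          -- the value is affine in `z`, and at most `ε` at both ends
          have hzz : 0 ≤ ε - z := by linarith
          have h4 := mul_nonneg hzz (sub_nonneg.2 hXm)
          have h5 := mul_nonneg hz₀ (sub_nonneg.2 hr')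
          refine le_of_mul_le_mul_right ?_ hε₀
          linarith
        · rw [value_go hlam hA]
          have hcosh := Real.one_le_cosh (π.lam * (g.d₁ + e₁))
          refine (ih t (by omega)).2 _ _ (hX'.go hlam hA) ?_ ?_
          · cases sh
            · exact hC
            · exact one_le_mul_of_one_le_of_one_le hC hcosh
          · rcases hc with hc | hc
            · left
              cases sh
              · exact hc
              · exact hc.trans (le_mul_of_one_le_right (by linarith) hcosh)
            · rcases hc.go hA with ⟨rfl, hd⟩ | hc'
              · left
                exact le_mul_of_one_le_of_le hC (by linarith) (hT _ (by linarith))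
              · exact .inr hc'
  exact (key t).1 i h

end Params
end WeakIPS

/-! ### Completeness: the honest prover. -/

namespace WeakIPS

namespace Params

variable {α : Type*} (π : Params α) (w : List α)

/-- `Path π w g l g'`: the messages `l` lead from the ledger `g` to the ledger `g'`. -/
inductive Path : Ledger → List Msg → Ledger → Prop
  | nil (g : Ledger) : Path g [] g
  | cons {g g' : Ledger} {m : Msg} {l : List Msg} {q' mv sh e₁ e₂ e₃} :
      π.action g.q m (tape w g.i) = .go q' mv sh e₁ e₂ e₃ →
      Path (g.next π q' mv sh e₁ e₂ e₃) l g' → Path g (m :: l) g'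

variable {π w}

lemma Path.append {g g' g'' : Ledger} {l l' : List Msg} (h : Path π w g l g')
    (h' : Path π w g' l' g'') : Path π w g (l ++ l') g'' := by
  induction h with
  | nil => exact h'
  | cons hA _ ih => exact .cons hA (ih h')

lemma Path.smallX (hlam : 0 ≤ π.lam) {g g' : Ledger} {l : List Msg} (h : Path π w g l g')
    (hg : SmallX π g) : SmallX π g' := by
  induction h with
  | nil => exact hg
  | cons hA _ ih => exact ih (hg.go hlam hA)

/-- Each message costs two steps of the verifier, one to communicate and one to read, and appends
one tick to the history. -/
lemma Path.value_eq (hlam : 0 ≤ π.lam) {P : π.verifier.Prover} {g g' : Ledger} {l : List Msg}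
    (hp : Path π w g l g') (t : ℕ) (h : List Msg)
    (hP : ∀ k (hk : k < l.length), π.reply P w (h ++ List.replicate k Msg.tick) = l[k]) :
    π.value P w (t + 2 * l.length) g h =
      π.value P w t g' (h ++ List.replicate l.length Msg.tick) := by
  induction hp generalizing h with
  | nil => simp
  | @cons g g' m l q' mv sh e₁ e₂ e₃ hA hp ih =>
    have h0 : π.reply P w h = m := by
      have := hP 0 (by simp)
      rwa [List.replicate_zero, List.append_nil] at this
    rw [List.length_cons, mul_add, mul_one, ← add_assoc, value_go hlam (h0 ▸ hA), ih]
    · simp [List.replicate_succ]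
    · intro k hk
      have := hP (k + 1) (by simpa using hk)
      simpa [List.replicate_succ] using this

variable (π w) in
/-- Some messages lead from phase `q`, head position `i` and discrepancies `d₁ d₂ d₃` to
`q'`, `i'`, `d₁' d₂' d₃'`, with all the tests completed meanwhile being passed exactly. -/
def Leads (q : Phase) (i : ℕ) (d₁ d₂ d₃ : ℝ) (q' : Phase) (i' : ℕ) (d₁' d₂' d₃' : ℝ) : Prop :=
  ∀ X, ∃ l X', Path π w ⟨q, i, d₁, d₂, d₃, X, 1⟩ l ⟨q', i', d₁', d₂', d₃', X', 1⟩

lemma Leads.refl (q i d₁ d₂ d₃) : Leads π w q i d₁ d₂ d₃ q i d₁ d₂ d₃ :=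
  fun X => ⟨[], X, .nil _⟩

lemma Leads.trans {q i d₁ d₂ d₃ q' i' d₁' d₂' d₃' q'' i'' d₁'' d₂'' d₃''}
    (h : Leads π w q i d₁ d₂ d₃ q' i' d₁' d₂' d₃')
    (h' : Leads π w q' i' d₁' d₂' d₃' q'' i'' d₁'' d₂'' d₃'') :
    Leads π w q i d₁ d₂ d₃ q'' i'' d₁'' d₂'' d₃'' := by
  intro X
  obtain ⟨l, X', hl⟩ := h X
  obtain ⟨l', X'', hl'⟩ := h' X'
  exact ⟨_, _, hl.append hl'⟩

lemma Leads.ticks {q i e₁ e₂ e₃}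
    (hA : π.action q .tick (tape w i) = .go q .stay false e₁ e₂ e₃) (u : ℕ) (d₁ d₂ d₃ : ℝ) :
    Leads π w q i d₁ d₂ d₃ q i (d₁ + u * e₁) (d₂ + u * e₂) (d₃ + u * e₃) := by
  induction u generalizing d₁ d₂ d₃ with
  | zero => simpa using Leads.refl q i d₁ d₂ d₃
  | succ u ih =>
    intro X
    obtain ⟨l, X', h⟩ := ih (d₁ + e₁) (d₂ + e₂) (d₃ + e₃)
      (X * Real.exp (-(π.lam * (|e₁| + |e₂| + |e₃|))))
    refine ⟨.tick :: l, X', .cons hA ?_⟩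
    convert h using 2 <;> first | rfl | (push_cast; ring)

/-- A block of the right length, followed by its end. -/
lemma Leads.block {q i e₂ e₃ m q' mv f₂ f₃}
    (hA : π.action q .tick (tape w i) = .go q .stay false 1 e₂ e₃)
    (hB : π.action q m (tape w i) = .go q' mv true 0 f₂ f₃) (u : ℕ) (d₃ : ℝ) :
    Leads π w q i (-u) 0 d₃ q' (mv.apply i) (u * e₂ + f₂) 0 (d₃ + u * e₃ + f₃) := by
  refine (Leads.ticks hA u (-u) 0 d₃).trans fun X =>
    ⟨[m], X * Real.exp (-(π.lam * (|0| + |f₂| + |f₃|))), .cons hB ?_⟩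
  convert Path.nil _ using 2 <;> simp [Ledger.next]

lemma leads_scan (j : ℕ) (hj : j ≤ w.length) :
    Leads π w .scan 1 0 0 0 .scan (j + 1) (-π.numeral (w.take j)) 0 0 := by
  induction j with
  | zero => simpa [numeral] using Leads.refl .scan 1 0 0 0
  | succ j ih =>
    have ht := tape_succ_of_lt (w := w) (j := j) hj
    have := Leads.block (π := π) (w := w) (q := .scan) (i := j + 1) (m := .sep)
      (by rw [ht]; rfl) (by rw [ht]; rfl) (π.numeral (w.take j)) 0
    refine (ih (by omega)).trans ?_
    simp only [Move.apply, mul_zero, add_zero] at this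
    convert this using 1
    · rw [List.take_add_one, List.getElem?_eq_getElem hj, Option.toList_some,
        numeral_append_singleton]
      push_cast
      ring

lemma leads_pow (i k : ℕ) (d₃ : ℝ) :
    Leads π w .pow i (-1) 0 d₃ .pow i (-8 ^ k) 0 (d₃ - k) := by
  induction k with
  | zero => simpa using Leads.refl .pow i (-1) 0 d₃
  | succ k ih =>
    have := Leads.block (π := π) (w := w) (q := .pow) (i := i) (m := .sep) rfl rfl (8 ^ k) (d₃ - k)
    refine ih.trans ?_
    push_cast at this ⊢
    simp only [Move.apply] at this
    convert this using 1 <;> ring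

lemma leads_last : Leads π w .scan 1 0 0 0 .last (w.length + 1) (-8 ^ π.numeral w) 0 0 := by
  have ht := tape_length_add_one (w := w)
  have h0 := leads_scan (π := π) (w := w) w.length le_rfl
  rw [List.take_length] at h0
  refine h0.trans ?_
  -- Numeral 0 calls for the power 8 ^ 0 only, so `jump` already ends the scan; otherwise it ends
  -- the block 8 ^ k.
  rcases hK : π.numeral w with _ | k
  · have := Leads.block (π := π) (w := w) (q := .scan) (i := w.length + 1) (m := .jump)
      (by rw [ht]; rfl) (by rw [ht]; rfl) 0 0
    simpa [Move.apply] using this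
  · have h1 := Leads.block (π := π) (w := w) (q := .scan) (i := w.length + 1) (m := .sep)
      (by rw [ht]; rfl) (by rw [ht]; rfl) (k + 1) 0
    have h2 := leads_pow (π := π) (w := w) (w.length + 1) k k
    have h3 := Leads.block (π := π) (w := w) (q := .pow) (i := w.length + 1) (m := .jump)
      rfl rfl (8 ^ k) 0
    simp only [Move.apply, Nat.cast_add, Nat.cast_one, Nat.cast_pow, Nat.cast_ofNat] at h1 h3 ⊢
    have h2' := h2.trans (by simpa using h3)
    refine h1.trans ?_
    convert h2' using 1 <;> ring

/-- The messages of the honest prover lead to the final test with the odd number `2 * m + 1`. -/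
lemma leads_fin (m : ℕ) : Leads π w .scan 1 0 0 0 .fin (w.length + 1)
    (2 * m + 1 - π.p * 8 ^ π.numeral w) 0 0 := by
  have h1 := Leads.block (π := π) (w := w) (q := .last) (i := w.length + 1) (m := .sep)
    rfl rfl (8 ^ π.numeral w) 0
  have h2 := Leads.ticks (π := π) (w := w) (q := .fin) (i := w.length + 1) (e₁ := 2) (e₂ := 0)
    (e₃ := 0) rfl m (1 - π.p * 8 ^ π.numeral w) 0 0
  simp only [Move.apply, Nat.cast_pow, Nat.cast_ofNat] at h1
  refine leads_last.trans (h1.trans ?_)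
  convert h2 using 1 <;> ring

/-- The prover that sends the word `W w` again and again on input `w`. -/
def cyclicProver (W : List α → List Msg) : π.verifier.Prover :=
  fun w h => (W w).getD ((h.length - 1) % (W w).length) Msg.tick

/-- One round with the honest prover. -/
lemma accBack_cyclicProver (hlam : 0 ≤ π.lam) (hm₀ : 0 ≤ π.mix) (hm₁ : π.mix ≤ 1)
    {W : List α → List Msg} {l : List Msg} (hW : W w = l ++ [Msg.sep]) {g : Ledger}
    (hl : Path π w .initial l g) (hq : g.q = .fin) (h : List Msg)
    (hh : (l.length + 1) ∣ h.length) :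
    ∃ T, ∃ h' : List Msg, (l.length + 1) ∣ h'.length ∧ ∀ t,
      π.accBack (cyclicProver W) w (t + T) 0 h =
      π.accBack (cyclicProver W) w t 0 h' + g.X * (π.mix * (1 - π.accBack (cyclicProver W) w t 0 h') -
        (1 - π.mix) * (g.C * Real.cosh (π.lam * g.d₁) * Real.cosh (π.lam * g.d₂) *
          Real.cosh (π.lam * g.d₃)) * π.accBack (cyclicProver W) w t 0 h') := by
  have hreply : ∀ k (hk : k < l.length + 1), π.reply (cyclicProver W) w
      (h ++ List.replicate k Msg.tick) = (l ++ [Msg.sep])[k]'(by simpa using hk) := by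
    intro k hk
    obtain ⟨c, hc⟩ := hh
    have hmod : (h.length + k) % (l.length + 1) = k := by
      rw [hc, Nat.mul_add_mod, Nat.mod_eq_of_lt hk]
    simp only [reply, cyclicProver, hW]
    have : ((h ++ List.replicate k Msg.tick ++ [Msg.tick]).length - 1) % (l ++ [Msg.sep]).length
        = k := by simpa using hmod
    change (l ++ [Msg.sep]).getD (((h ++ List.replicate k Msg.tick ++ [Msg.tick]).length - 1) %
      (l ++ [Msg.sep]).length) Msg.tick = _
    rw [this, List.getD_eq_getElem]
  -- One step leaves the left end-marker, each message including the final `sep` takes two, and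
  -- `g.i` steps bring the head back.
  refine ⟨(g.i + 2 + 2 * l.length) + 1, h ++ List.replicate l.length Msg.tick ++ [Msg.tick], ?_,
    fun t => ?_⟩
  · simpa [add_assoc] using hh
  · have hfin : π.action g.q (π.reply (cyclicProver W) w (h ++ List.replicate l.length Msg.tick))
        (tape w g.i) = .finish := by
      rw [hreply _ l.length.lt_succ_self, hq]
      simp [action]
    rw [← add_assoc, accBack_succ_zero hm₀ hm₁, ← add_assoc, ← add_assoc, hl.value_eq hlam,
      value_finish hfin, accBack_add]
    intro k hk
    rw [hreply k (by omega), List.getElem_append_left hk]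

/-- The solution of the recursion for the acceptance probability after `n` rounds. -/
lemma one_sub_pow_le {a r : ℝ} (ha : 0 < a) (hr : 0 ≤ r) (har : a + r ≤ 1) {ι : Type*}
    {f : ℕ → ι → ℝ} (h₀ : ∀ t x, 0 ≤ f t x)
    (hf : ∀ x, ∃ T y, ∀ t, f (t + T) x = f t y + (a * (1 - f t y) - r * f t y)) (n : ℕ) (x : ι) :
    ∃ t, a / (a + r) * (1 - (1 - a - r) ^ n) ≤ f t x := by
  induction n generalizing x with
  | zero => exact ⟨0, by simpa using h₀ 0 x⟩
  | succ n ih =>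
    obtain ⟨T, y, hy⟩ := hf x
    obtain ⟨t, ht⟩ := ih y
    refine ⟨t + T, ?_⟩
    rw [hy]
    have h1 : a / (a + r) * (a + r) = a := div_mul_cancel₀ _ (by positivity)
    have h2 := mul_le_mul_of_nonneg_left ht (by linarith : 0 ≤ 1 - a - r)
    calc a / (a + r) * (1 - (1 - a - r) ^ (n + 1))
        = (1 - a - r) * (a / (a + r) * (1 - (1 - a - r) ^ n)) + a / (a + r) * (a + r) := by ring
      _ ≤ (1 - a - r) * f t y + a := by rw [h1]; linarith
      _ = _ := by ring

/-- With the honest prover, a word whose code is close to the odd number `2 * m + 1` is accepted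
with probability at least `1 - ε`. -/
theorem acceptProb_cyclicProver {ε B : ℝ} (hε₀ : 0 < ε) (hlam : 0 ≤ π.lam) (hm₀ : 0 < π.mix)
    (hm₁ : π.mix ≤ 1) (hB : ∀ d, |d| ≤ 1 / 4 → Real.cosh (π.lam * d) ≤ B)
    (hB₁ : Real.exp (-π.lam) * B ≤ 1) (hmix : (1 - π.mix) * B ≤ ε * π.mix)
    {W : List α → List Msg} {l : List Msg} (hW : W w = l ++ [Msg.sep]) {m : ℕ} {X : ℝ}
    (hm : |2 * (m : ℝ) + 1 - π.p * 8 ^ π.numeral w| ≤ 1 / 4)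
    (hl : Path π w .initial l
      ⟨.fin, w.length + 1, 2 * m + 1 - π.p * 8 ^ π.numeral w, 0, 0, X, 1⟩) :
    ENNReal.ofReal (1 - ε) ≤ π.verifier.acceptProb (cyclicProver W) w := by
  have hX := hl.smallX hlam smallX_initial
  obtain ⟨hX₀, -, hX₁⟩ := hX
  replace hX₁ := hX₁ (by simp)
  simp only at hX₀ hX₁
  have hQB := hB _ hm
  have hQ₁ := Real.one_le_cosh (π.lam * (2 * (m : ℝ) + 1 - π.p * 8 ^ π.numeral w))
  have hround := accBack_cyclicProver hlam hm₀.le hm₁ hW hl rfl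
  simp only [mul_zero, Real.cosh_zero, mul_one, one_mul] at hround
  generalize Real.cosh (π.lam * (2 * (m : ℝ) + 1 - π.p * 8 ^ π.numeral w)) = Q at *
  have h1m := sub_nonneg.2 hm₁
  have hXB : X * B ≤ 1 := (mul_le_mul_of_nonneg_right hX₁ (by linarith)).trans hB₁
  have ha : 0 < X * π.mix := by positivity
  have hr : 0 ≤ X * (1 - π.mix) * Q := by positivity
  have hXQ : X * Q ≤ 1 := (mul_le_mul_of_nonneg_left hQB hX₀.le).trans hXB
  have hXX : X ≤ 1 := (le_mul_of_one_le_right hX₀.le hQ₁).trans hXQ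
  have har : X * π.mix + X * (1 - π.mix) * Q ≤ 1 := by
    have e1 := mul_le_mul_of_nonneg_right hXX hm₀.le
    have e2 := mul_le_mul_of_nonneg_right hXQ h1m
    linarith
  have hra : X * (1 - π.mix) * Q ≤ ε * (X * π.mix) := by
    have e1 : (1 - π.mix) * Q ≤ ε * π.mix := (mul_le_mul_of_nonneg_left hQB h1m).trans hmix
    have e2 := mul_le_mul_of_nonneg_left e1 hX₀.le
    linarith
  -- Histories whose length is a multiple of the period are exactly those at which the cyclic
  -- message starts afresh.
  have hrec := one_sub_pow_le ha hr har
    (f := fun t (h : {h : List Msg // (l.length + 1) ∣ h.length}) =>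
      π.accBack (cyclicProver W) w t 0 h) (fun _ _ => Verifier.accFrom_nonneg _ _ _ _ _) (by
        rintro ⟨h, hh⟩
        obtain ⟨T, h', hh', hT⟩ := hround h hh
        refine ⟨T, ⟨h', hh'⟩, fun t => ?_⟩
        simp only [hT t]
        ring)
  generalize X * π.mix = a at *
  generalize X * (1 - π.mix) * Q = r at *
  refine Verifier.le_acceptProb _ _ _ fun b hb => ?_
  have hlim : Filter.Tendsto (fun n : ℕ => a / (a + r) * (1 - (1 - a - r) ^ n)) Filter.atTop
      (nhds (a / (a + r) * (1 - 0))) :=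
    ((tendsto_pow_atTop_nhds_zero_of_lt_one (by linarith) (by linarith)).const_sub 1).const_mul _
  have hlt : b < a / (a + r) * (1 - 0) := by
    refine hb.trans_le ?_
    rw [sub_zero, mul_one, le_div_iff₀ (by positivity)]
    have := mul_nonneg hε₀.le hr
    linarith
  obtain ⟨n, hn⟩ := (hlim.eventually_const_lt hlt).exists
  obtain ⟨t, ht⟩ := hrec n ⟨[], by simp⟩
  exact ⟨t, hn.le.trans ht⟩

end Params
end WeakIPS

/-! ### Choice of the parameters. -/

theorem theorem4 {α : Type*} [Finite α] (L : Language α) (ε : ℝ) (hε₀ : 0 < ε) (hε : ε < 1 / 2) :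
    ∃ (V : WeakIPS.Verifier α) (P : V.Prover), V.IsSweeping ∧ V.IsWeakIPS P L ε := by
  classical
  let digit : α → ℕ := fun a => Finite.equivFin α a + 1
  have hinj : Function.Injective digit := fun a b h =>
    (Finite.equivFin α).injective (Fin.ext (Nat.add_right_cancel h))
  let num : List α → ℕ := fun w => w.foldl (fun k a => (Nat.card α + 1) * k + digit a) 0
  obtain ⟨p, hp₁, hp₀⟩ := WeakIPS.exists_encoding (num '' L)
  -- With β = 2 / ε, this gives exp(lam / 4) = β, so the final test contributes at most β for
  -- members, while a failed test contributes at least β ^ 3 / 2. The prior odds of rejecting, ε ^ 2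
  -- / 2, turn these into odds at most ε and at least 2 / ε.
  let π : WeakIPS.Params α :=
    { lam := 4 * Real.log (2 / ε), p := p, mix := (1 + ε ^ 2 / 2)⁻¹, base := Nat.card α + 1,
      digit := digit }
  have hnum : Function.Injective num := π.numeral_injective hinj (fun a => Nat.succ_pos _)
    fun a => Nat.succ_lt_succ (Finite.equivFin α a).isLt
  have hβ : 1 < 2 / ε := by rw [lt_div_iff₀ hε₀]; linarith
  have hlog : 0 < Real.log (2 / ε) := Real.log_pos hβ
  have hlam : 0 ≤ π.lam := by positivity
  have hexp : ∀ k : ℕ, Real.exp (k * Real.log (2 / ε)) = (2 / ε) ^ k := fun k => by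
    rw [Real.exp_nat_mul, Real.exp_log (by positivity)]
  have hexp4 : Real.exp (-π.lam) = (ε / 2) ^ 4 := by
    have := hexp 4
    rw [Real.exp_neg, show π.lam = ((4 : ℕ) : ℝ) * Real.log (2 / ε) by simp [π], this, ← inv_pow,
      inv_div]
  have hm₀ : 0 < π.mix := by positivity
  have hm₁ : π.mix ≤ 1 := inv_le_one_of_one_le₀ (by nlinarith)
  have hmm : π.mix * (1 + ε ^ 2 / 2) = 1 := inv_mul_cancel₀ (by positivity)
  have hmm' : 1 - π.mix = π.mix * (ε ^ 2 / 2) := by linarith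
  have hW : ∀ w, ∃ l : List WeakIPS.Msg, (∃ m : ℕ, |2 * (m : ℝ) + 1 - p * 8 ^ num w| ≤ 1 / 4) →
      ∃ (m : ℕ) (X : ℝ),
        |2 * (m : ℝ) + 1 - p * 8 ^ num w| ≤ 1 / 4 ∧ WeakIPS.Params.Path π w .initial l
          ⟨.fin, w.length + 1, 2 * m + 1 - π.p * 8 ^ π.numeral w, 0, 0, X, 1⟩ := by
    intro w
    by_cases h : ∃ m : ℕ, |2 * (m : ℝ) + 1 - p * 8 ^ num w| ≤ 1 / 4
    · obtain ⟨m, hm⟩ := h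
      obtain ⟨l, X, hl⟩ := WeakIPS.Params.leads_fin (π := π) (w := w) m 1
      exact ⟨l, fun _ => ⟨m, X, hm, hl⟩⟩
    · exact ⟨[], fun h' => absurd h' h⟩
  choose W hW using hW
  refine ⟨π.verifier, WeakIPS.Params.cyclicProver fun w => W w ++ [.sep], π.isSweeping_verifier,
    fun w hw => ?_, fun w hw P => ?_⟩
  · obtain ⟨m, X, hm, hl⟩ := hW w (hp₁ _ (Set.mem_image_of_mem num hw))
    refine WeakIPS.Params.acceptProb_cyclicProver (B := 2 / ε) hε₀ hlam hm₀ hm₁ ?_ ?_ ?_ rfl hm hl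
    · intro d hd
      have hle : |π.lam * d| ≤ Real.log (2 / ε) := by
        rw [abs_mul, abs_of_nonneg hlam]
        calc π.lam * |d| ≤ π.lam * (1 / 4) := by gcongr
          _ = _ := by simp only [π]; ring
      rw [← Real.exp_log (show 0 < 2 / ε by positivity), ← Real.cosh_abs, Real.cosh_eq]
      have h1 := Real.exp_le_exp.2 hle
      have h2 : Real.exp (-|π.lam * d|) ≤ Real.exp |π.lam * d| :=
        Real.exp_le_exp.2 (by linarith [abs_nonneg (π.lam * d)])
      linarith
    · rw [hexp4, show (ε / 2) ^ 4 * (2 / ε) = (ε / 2) ^ 3 by field_simp]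
      exact pow_le_one₀ (by positivity) (by linarith)
    · rw [hmm']
      refine le_of_eq ?_
      field_simp
  · refine WeakIPS.Verifier.acceptProb_le _ _ _ fun t =>
      WeakIPS.Params.accBack_le (T := (2 / ε) ^ 3 / 2) hε₀ hlam hm₀.le hm₁ ?_ ?_ ?_ ?_ P t 0 []
    · intro d hd
      have hle : ((3 : ℕ) : ℝ) * Real.log (2 / ε) ≤ |π.lam * d| := by
        rw [abs_mul, abs_of_nonneg hlam]
        calc ((3 : ℕ) : ℝ) * Real.log (2 / ε) = π.lam * (3 / 4) := by simp only [π]; push_cast; ring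
          _ ≤ _ := by gcongr
      rw [← hexp 3, ← Real.cosh_abs, Real.cosh_eq]
      have h1 := Real.exp_le_exp.2 hle
      have h2 := Real.exp_pos (-|π.lam * d|)
      linarith
    · rw [hexp4]
      calc (ε / 2) ^ 4 ≤ (ε / 2) ^ 1 := pow_le_pow_of_le_one (by positivity) (by linarith) (by norm_num)
        _ ≤ ε := by linarith
    · have : (1 - π.mix) * ((2 / ε) ^ 3 / 2) * ε = π.mix * 2 := by
        rw [hmm']
        field_simp
      rw [this]
      exact mul_le_mul_of_nonneg_left (by linarith) hm₀.le
    · refine hp₀ _ ?_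
      rintro ⟨v, hv, hvw⟩
      exact hw (hnum hvw ▸ hv)
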